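/- Let $n\ge 3$ and let $\Omega\subset\mathbb{R}^n$ be a bounded open set (for instance a bounded domain with smooth boundary). Let $H^1_0(\Omega)$ be the closure of $C_c^\infty(\Omega;\mathbb{C})$ in $H^1(\Omega)$, let $H^{-1}(\Omega)$ be the space of continuous conjugate-linear functionals on $H^1_0(\Omega)$, and regard $f\in L^{2n/(n+2)}(\Omega;\mathbb{C})$ as the element $v\mapsto\int_\Omega f\bar v$ of $H^{-1}(\Omega)$ (the integrals converge and define a continuous functional). Let $q\in L^{n/2}(\Omega;\mathbb{R})$, put $\Phi(u,v)=\int_\Omega(\nabla u\cdot\nabla\bar v+q\,u\bar v)\,dx$ for $u,v\in H^1_0(\Omega)$, and assume that there is $c>0$ such that $$c\,\|u\|_{H^1(\Omega)}^2\le \Phi(u,u)\qquad\text{for all }u\in H^1_0(\Omega).$$ For $m\in\mathbb{N}$, $m\ge1$, let $\tau(m)=(m+i)^2$. Then for every $m\ge 1$ the Dirichlet resolvent $R_q(\tau(m))=(-\Delta+q-\tau(m))^{-1}\colon H^{-1}(\Omega)\to H^1_0(\Omega)$, which maps $F$ to the unique $u\in H^1_0(\Omega)$ with $\Phi(u,v)-\tau(m)\int_\Omega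 u\bar v\,dx=F(v)$ for all $v\in H^1_0(\Omega)$, exists as a bounded linear operator, and there is a constant $C>0$, independent of $m$ and $f$, such that $$\|R_q(\tau(m))f\|_{L^{2n/(n-2)}(\Omega)}\le C\,|\operatorname{Im}\tau(m)|\,\|f\|_{L^{2n/(n+2)}(\Omega)}$$ for all $m\ge1$ and all $f\in L^{2n/(n+2)}(\Omega;\mathbb{C})$. -/

import Mathlib

open MeasureTheory
open scoped ContDiff ComplexConjugate

noncomputable section

namespace DirichletSchrodinger

/-- `L²(Ω; ℂ)` for a subset `Ω` of `ℝⁿ` with Lebesgue measure. -/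
abbrev L2 {n : ℕ} (Ω : Set (EuclideanSpace ℝ (Fin n))) : Type :=
  Lp ℂ 2 (volume.restrict Ω)

/-- The Hilbert space of pairs `(u, g)` with `u ∈ L²(Ω)` and `g ∈ L²(Ω)ⁿ`, with norm
`‖(u, g)‖² = ‖u‖² + ∑ i, ‖g i‖²`. On pairs `(u, ∇u)` this is the norm of `H¹(Ω)`. -/
abbrev Jet {n : ℕ} (Ω : Set (EuclideanSpace ℝ (Fin n))) : Type :=
  WithLp 2 (L2 Ω × PiLp 2 (fun _ : Fin n => L2 Ω))

/-- Smooth complex-valued functions with compact support contained in `Ω`. -/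
def IsTest {n : ℕ} (Ω : Set (EuclideanSpace ℝ (Fin n)))
    (φ : EuclideanSpace ℝ (Fin n) → ℂ) : Prop :=
  ContDiff ℝ ∞ φ ∧ HasCompactSupport φ ∧ tsupport φ ⊆ Ω

/-- The partial derivative of `φ` in the `i`-th coordinate direction. -/
def partialDeriv {n : ℕ} (i : Fin n) (φ : EuclideanSpace ℝ (Fin n) → ℂ)
    (x : EuclideanSpace ℝ (Fin n)) : ℂ :=
  fderiv ℝ φ x (EuclideanSpace.single i 1)

/-- The subspace of all pairs `(φ, ∇φ)`, `φ ∈ C_c^∞(Ω)`. -/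
def testJets {n : ℕ} (Ω : Set (EuclideanSpace ℝ (Fin n))) : Submodule ℂ (Jet Ω) where
  carrier := {w | ∃ φ, IsTest Ω φ ∧ (w.fst : _ → ℂ) =ᵐ[volume.restrict Ω] φ ∧
    ∀ i, (w.snd i : _ → ℂ) =ᵐ[volume.restrict Ω] partialDeriv i φ}
  zero_mem' := by
    refine ⟨0, ⟨contDiff_const, HasCompactSupport.zero, by simp [tsupport]⟩, ?_, fun i => ?_⟩
    · exact Lp.coeFn_zero _ _ _
    · refine (Lp.coeFn_zero ℂ 2 (volume.restrict Ω)).trans (Filter.Eventually.of_forall ?_)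
      intro x
      simp [partialDeriv]
  add_mem' := by
    rintro a b ⟨φ, ⟨h1, h2, h3⟩, ha, ha'⟩ ⟨ψ, ⟨k1, k2, k3⟩, hb, hb'⟩
    refine ⟨φ + ψ, ⟨h1.add k1, h2.add k2,
      (tsupport_add φ ψ).trans (Set.union_subset h3 k3)⟩, ?_, fun i => ?_⟩
    · exact (Lp.coeFn_add a.fst b.fst).trans (ha.add hb)
    · refine (Lp.coeFn_add (a.snd i) (b.snd i)).trans
        (((ha' i).add (hb' i)).trans (Filter.Eventually.of_forall ?_))
      intro x
      simp only [partialDeriv, Pi.add_apply]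
      rw [fderiv_add (h1.differentiable (by simp) x) (k1.differentiable (by simp) x)]
      rfl
  smul_mem' := by
    rintro c a ⟨φ, ⟨h1, h2, h3⟩, ha, ha'⟩
    refine ⟨c • φ, ⟨h1.const_smul c, h2.smul_left (f := fun _ => c),
      (tsupport_smul_subset_right (fun _ => c) φ).trans h3⟩, ?_, fun i => ?_⟩
    · exact (Lp.coeFn_smul c a.fst).trans (ha.const_smul c)
    · refine (Lp.coeFn_smul c (a.snd i)).trans
        (((ha' i).const_smul c).trans (Filter.Eventually.of_forall ?_))
      intro x
      simp only [partialDeriv, Pi.smul_apply]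
      rw [fderiv_const_smul (h1.differentiable (by simp) x)]
      rfl

/-- `H¹₀(Ω)`: the closure of `C_c^∞(Ω)` in the `H¹` norm. A member is stored as the pair
`(u, ∇u)`: if `φₖ → u` and `∂ᵢφₖ → gᵢ` in `L²(Ω)`, then `g` is the weak gradient of `u`
(pass to the limit in `∫ φₖ ∂ᵢψ = - ∫ ψ ∂ᵢφₖ`), hence is determined by `u`. -/
abbrev H10 {n : ℕ} (Ω : Set (EuclideanSpace ℝ (Fin n))) : Submodule ℂ (Jet Ω) :=
  (testJets Ω).topologicalClosure

/-- The function underlying a member of `H¹₀(Ω)`. -/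
def fn {n : ℕ} {Ω : Set (EuclideanSpace ℝ (Fin n))} (u : H10 Ω) :
    EuclideanSpace ℝ (Fin n) → ℂ :=
  (u : Jet Ω).fst

/-- The `i`-th weak partial derivative of a member of `H¹₀(Ω)`. -/
def grad {n : ℕ} {Ω : Set (EuclideanSpace ℝ (Fin n))} (u : H10 Ω) (i : Fin n) :
    EuclideanSpace ℝ (Fin n) → ℂ :=
  (u : Jet Ω).snd i

/-- `H⁻¹(Ω)`: the continuous conjugate-linear functionals on `H¹₀(Ω)`, with the dual norm. -/
abbrev HNegOne {n : ℕ} (Ω : Set (EuclideanSpace ℝ (Fin n))) : Type :=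
  H10 Ω →L⋆[ℂ] ℂ

/-- The sesquilinear form `Φ(u, v) = ∫_Ω ∇u · conj ∇v + q u conj v`, that is, the pairing
`⟨(-Δ + q) u, v⟩`. -/
def form {n : ℕ} {Ω : Set (EuclideanSpace ℝ (Fin n))} (q : EuclideanSpace ℝ (Fin n) → ℝ)
    (u v : H10 Ω) : ℂ :=
  (∑ i, ∫ x in Ω, grad u i x * conj (grad v i x)) +
    ∫ x in Ω, (q x : ℂ) * fn u x * conj (fn v x)

/-- `-Δ + q` is positive on `H¹₀(Ω)`: `c ‖u‖²_{H¹} ≤ ⟨(-Δ + q) u, u⟩` for some `c > 0`. -/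
def IsPositive {n : ℕ} (Ω : Set (EuclideanSpace ℝ (Fin n)))
    (q : EuclideanSpace ℝ (Fin n) → ℝ) : Prop :=
  ∃ c : ℝ, 0 < c ∧ ∀ u : H10 Ω, c * ‖u‖ ^ 2 ≤ (form q u u).re

/-- `R` is the Dirichlet resolvent `(-Δ + q - z)⁻¹ : H⁻¹(Ω) → H¹₀(Ω)`: for every `F`, `R F` is the
one and only `u ∈ H¹₀(Ω)` with `⟨(-Δ + q - z) u, v⟩ = ⟨F, v⟩` for all `v ∈ H¹₀(Ω)`.
There is at most one such `R`. -/
def IsDirichletResolvent {n : ℕ} {Ω : Set (EuclideanSpace ℝ (Fin n))}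
    (q : EuclideanSpace ℝ (Fin n) → ℝ) (z : ℂ) (R : HNegOne Ω →L[ℂ] H10 Ω) : Prop :=
  ∀ (F : HNegOne Ω) (u : H10 Ω),
    R F = u ↔ ∀ v : H10 Ω, form q u v - z * ∫ x in Ω, fn u x * conj (fn v x) = F v

/-- `F ∈ H⁻¹(Ω)` is the functional `v ↦ ∫_Ω f conj v` given by the function `f`. -/
def IsGivenBy {n : ℕ} {Ω : Set (EuclideanSpace ℝ (Fin n))} (F : HNegOne Ω)
    (f : EuclideanSpace ℝ (Fin n) → ℂ) : Prop :=
  ∀ v : H10 Ω, IntegrableOn (fun x => f x * conj (fn v x)) Ω ∧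
    F v = ∫ x in Ω, f x * conj (fn v x)

/-- The spectral parameter `τ(m) = (m + i)²`. -/
def tau (m : ℕ) : ℂ := ((m : ℂ) + Complex.I) ^ 2

end DirichletSchrodinger

end

noncomputable section

namespace DirichletSchrodinger

open Filter Topology
open scoped NNReal ENNReal InnerProductSpace

/-! Write `P = Φ(u, u)` and `N = ‖u‖²` in `L²`. Since `q` is real, `P` is real, so `|P - τN|` is at
least the distance from `P` to the line `ℝτ`, namely `P |Im τ| / |τ|`. For `τ = (m + i)²` this ratio
is `2m / (m² + 1) ≥ 1/m`, so the shifted form is coercive with constant `c/m`, and Lax–Milgram gives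
a resolvent of norm at most `m/c` from `H⁻¹` to `H¹₀` (`exists_resolvent_bound`). The Sobolev
embedding (`exists_eLpNorm_fn_le`) and its dual (`exists_isGivenBy`) turn this into the
`L^{2n/(n+2)} → L^{2n/(n-2)}` bound at the cost of one Sobolev constant each, and `m = Im τ / 2`. By
Hölder, the same embedding makes `q` a bounded map `H¹₀ → H⁻¹`. -/

/-! ### Lax–Milgram -/

/-- The Lax–Milgram theorem for a bounded sesquilinear form on a complex Hilbert space. -/
theorem bijective_of_coercive {H : Type*} [NormedAddCommGroup H] [InnerProductSpace ℂ H]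
    [CompleteSpace H] (T : H →L[ℂ] H →L⋆[ℂ] ℂ) {k : ℝ} (hk : 0 < k)
    (hT : ∀ u, k * ‖u‖ ^ 2 ≤ ‖T u u‖) : Function.Bijective T := by
  let A : H →L[ℂ] H :=
    ContinuousLinearMap.adjoint (InnerProductSpace.continuousLinearMapOfBilin T.flip)
  have hA (u v : H) : ⟪v, A u⟫_ℂ = T u v := by
    rw [ContinuousLinearMap.adjoint_inner_right,
      InnerProductSpace.continuousLinearMapOfBilin_apply, ContinuousLinearMap.flip_apply]
  have hzero (u : H) (h : T u u = 0) : u = 0 := by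
    have h1 := hT u
    rw [h, norm_zero] at h1
    have h2 : ‖u‖ ^ 2 ≤ 0 := nonpos_of_mul_nonpos_right h1 hk
    simpa using le_antisymm h2 (by positivity)
  have hbelow (u : H) : k * ‖u‖ ≤ ‖A u‖ := by
    rcases (norm_nonneg u).eq_or_lt' with h | h
    · simp [h]
    · refine le_of_mul_le_mul_right ?_ h
      calc k * ‖u‖ * ‖u‖ = k * ‖u‖ ^ 2 := by ring
        _ ≤ ‖⟪u, A u⟫_ℂ‖ := by rw [hA]; exact hT u
        _ ≤ ‖A u‖ * ‖u‖ := by rw [mul_comm]; exact norm_inner_le_norm _ _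
  have hanti : AntilipschitzWith k⁻¹.toNNReal A := by
    refine A.antilipschitz_of_bound fun u => ?_
    rw [Real.coe_toNNReal _ (by positivity), inv_mul_eq_div, le_div_iff₀' hk]
    exact hbelow u
  have hclosed : IsClosed (A.range : Set H) := hanti.isClosed_range A.uniformContinuous
  -- A closed subspace is its own double orthogonal complement, and any `w` orthogonal to the range
  -- has `T w w = 0`, hence vanishes.
  have hrange : A.range = ⊤ := by
    have := hclosed.completeSpace_coe
    rw [← A.range.orthogonal_orthogonal, Submodule.eq_top_iff']
    intro v w hw
    have : T w w = 0 := by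
      have h : ⟪A w, w⟫_ℂ = 0 := hw _ ⟨w, rfl⟩
      rw [← hA, ← inner_conj_symm, h, map_zero]
    rw [hzero w this, inner_zero_left]
  constructor
  · rw [injective_iff_map_eq_zero]
    intro u hu
    exact hzero u (by simp [hu])
  · intro F
    -- Conjugating `F` makes it linear, so that the Riesz representation applies.
    let G : StrongDual ℂ H := (starL ℂ : ℂ ≃L⋆[ℂ] ℂ).toContinuousLinearMap.comp F
    obtain ⟨u, hu⟩ := LinearMap.range_eq_top.mp hrange ((InnerProductSpace.toDual ℂ H).symm G)
    refine ⟨u, ContinuousLinearMap.ext fun v => ?_⟩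
    change A u = _ at hu
    rw [← hA, hu, ← inner_conj_symm, InnerProductSpace.toDual_symm_apply]
    change conj (conj (F v)) = F v
    exact Complex.conj_conj _

/-- The solution operator of the Lax–Milgram theorem, with the bound for its norm. -/
theorem exists_equiv_of_coercive {H : Type*} [NormedAddCommGroup H] [InnerProductSpace ℂ H]
    [CompleteSpace H] (T : H →L[ℂ] H →L⋆[ℂ] ℂ) {k : ℝ} (hk : 0 < k)
    (hT : ∀ u, k * ‖u‖ ^ 2 ≤ ‖T u u‖) :
    ∃ e : H ≃L[ℂ] (H →L⋆[ℂ] ℂ), (∀ u, e u = T u) ∧ ∀ F, ‖e.symm F‖ ≤ k⁻¹ * ‖F‖ := by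
  have hbij := bijective_of_coercive T hk hT
  let e := ContinuousLinearEquiv.ofBijective T (LinearMap.ker_eq_bot.mpr hbij.1)
    (LinearMap.range_eq_top.mpr hbij.2)
  refine ⟨e, fun u => rfl, fun F => ?_⟩
  obtain ⟨u, rfl⟩ := e.surjective F
  rw [e.symm_apply_apply, inv_mul_eq_div, le_div_iff₀' hk]
  change k * ‖u‖ ≤ ‖T u‖
  rcases (norm_nonneg u).eq_or_lt' with h | h
  · simp [h]
  · refine le_of_mul_le_mul_right ?_ h
    rw [mul_assoc, ← sq]
    exact (hT u).trans ((T u).le_opNorm u)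

/-! ### Distance to the line spanned by the spectral parameter -/

/-- `t ↦ |P - z t|` is bounded below by the distance of `P` to the line `ℝ z`. -/
theorem mul_im_le_norm_mul_norm_sub (z : ℂ) (P N : ℝ) :
    P * z.im ≤ ‖z‖ * ‖(P : ℂ) - z * N‖ := by
  -- Multiplication by `i conj z` sends the line `ℝz` into the imaginary axis, so the real part no
  -- longer sees `N`.
  have h : (Complex.I * conj z * ((P : ℂ) - z * N)).re = P * z.im := by
    simp
    ring
  calc P * z.im ≤ ‖Complex.I * conj z * ((P : ℂ) - z * N)‖ := h ▸ Complex.re_le_norm _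
    _ = ‖z‖ * ‖(P : ℂ) - z * N‖ := by simp

theorem tau_im (m : ℕ) : (tau m).im = 2 * m := by
  simp [tau, sq]
  ring

theorem norm_tau (m : ℕ) : ‖tau m‖ = (m : ℝ) ^ 2 + 1 := by
  rw [tau, norm_pow, Complex.sq_norm, Complex.normSq_apply]
  simp
  ring

/-- A lower bound for `|P - τ(m) N|` with the dependence on `m` explicit. -/
theorem le_norm_sub_tau_mul {m : ℕ} (hm : 1 ≤ m) (P N : ℝ) :
    P / m ≤ ‖(P : ℂ) - tau m * N‖ := by
  have h := mul_im_le_norm_mul_norm_sub (tau m) P N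
  rw [tau_im, norm_tau] at h
  have hm' : (1 : ℝ) ≤ m := by exact_mod_cast hm
  have hm2 : (m : ℝ) ^ 2 + 1 ≤ 2 * (m : ℝ) ^ 2 := by nlinarith
  have h2 : P * (2 * m) ≤ 2 * (m : ℝ) ^ 2 * ‖(P : ℂ) - tau m * N‖ :=
    h.trans (mul_le_mul_of_nonneg_right hm2 (norm_nonneg _))
  rw [div_le_iff₀ (by linarith)]
  refine le_of_mul_le_mul_left ?_ (show (0 : ℝ) < 2 * m by linarith)
  linarith

/-! ### Sobolev embedding -/

variable {n : ℕ} {Ω : Set (EuclideanSpace ℝ (Fin n))}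

/-- Links the full derivative in the Sobolev inequality to the partial derivatives that make up the
`H¹` norm. -/
theorem norm_fderiv_le_sum_partialDeriv (φ : EuclideanSpace ℝ (Fin n) → ℂ)
    (x : EuclideanSpace ℝ (Fin n)) : ‖fderiv ℝ φ x‖ ≤ ∑ i, ‖partialDeriv i φ x‖ := by
  refine ContinuousLinearMap.opNorm_le_bound _ (by positivity) fun y => ?_
  have hy : y = ∑ i, y i • EuclideanSpace.single i (1 : ℝ) := by
    ext j
    simp [Finset.sum_apply, Pi.single_apply]
  conv_lhs => rw [hy, map_sum]
  rw [Finset.sum_mul]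
  refine (norm_sum_le _ _).trans (Finset.sum_le_sum fun i _ => ?_)
  rw [map_smul, norm_smul, mul_comm]
  exact mul_le_mul_of_nonneg_left (PiLp.norm_apply_le y i) (norm_nonneg _)

/-- The Sobolev inequality for test functions, in terms of the `H¹` norm. -/
theorem exists_eLpNorm_fst_le_of_mem_testJets (hn : 3 ≤ n)
    (Ω : Set (EuclideanSpace ℝ (Fin n))) :
    ∃ S : ℝ≥0, ∀ w ∈ testJets Ω,
      eLpNorm (w.fst : _ → ℂ) (ENNReal.ofReal (2 * (n : ℝ) / ((n : ℝ) - 2)))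
        (volume.restrict Ω) ≤ S * ‖w‖ₑ := by
  have hn' : (3 : ℝ) ≤ n := by exact_mod_cast hn
  let C : ℝ≥0 := eLpNormLESNormFDerivOfEqInnerConst
    (volume : Measure (EuclideanSpace ℝ (Fin n))) ((2 : ℝ≥0) : ℝ)
  refine ⟨C * n, ?_⟩
  rintro w ⟨φ, ⟨h1, h2, h3⟩, hw, hw'⟩
  have hsupp : Function.support (fun x => ‖fderiv ℝ φ x‖) ⊆ Ω := fun x hx =>
    h3 (tsupport_fderiv_subset ℝ (subset_tsupport _ (norm_ne_zero_iff.mp hx)))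
  have hmeas (i : Fin n) : AEStronglyMeasurable (fun x => ‖partialDeriv i φ x‖)
      (volume.restrict Ω) :=
    ((Lp.aestronglyMeasurable (w.snd i)).congr (hw' i)).norm
  have hgrad : eLpNorm (fderiv ℝ φ) 2 volume ≤ n * ‖w‖ₑ := by
    rw [← eLpNorm_norm, ← eLpNorm_restrict_eq_of_support_subset hsupp, eLpNorm_norm]
    calc eLpNorm (fderiv ℝ φ) 2 (volume.restrict Ω)
        ≤ eLpNorm (∑ i, fun x => ‖partialDeriv i φ x‖) 2 (volume.restrict Ω) := by
          refine eLpNorm_mono_real fun x => ?_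
          rw [Finset.sum_apply]
          exact norm_fderiv_le_sum_partialDeriv φ x
      _ ≤ ∑ i, eLpNorm (fun x => ‖partialDeriv i φ x‖) 2 (volume.restrict Ω) :=
          eLpNorm_sum_le (fun i _ => hmeas i) (by norm_num)
      _ ≤ ∑ _i : Fin n, ‖w‖ₑ := by
          refine Finset.sum_le_sum fun i _ => ?_
          rw [eLpNorm_norm, ← eLpNorm_congr_ae (hw' i), ← Lp.enorm_def, enorm_le_iff_norm_le]
          exact (PiLp.norm_apply_le w.snd i).trans (WithLp.norm_snd_le _ w)
      _ = n * ‖w‖ₑ := by simp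
  -- Gagliardo–Nirenberg–Sobolev on all of `ℝⁿ`, with `1/p' = 1/2 - 1/n`.
  have hsob := eLpNorm_le_eLpNorm_fderiv_of_eq_inner
    (volume : Measure (EuclideanSpace ℝ (Fin n))) (u := φ) (h1.of_le (by simp)) h2
    (p := 2) (p' := (2 * (n : ℝ) / ((n : ℝ) - 2)).toNNReal) (by norm_num)
    (by simp; omega) (by
      rw [Real.coe_toNNReal _ (div_nonneg (by linarith) (by linarith))]
      simp only [finrank_euclideanSpace, Fintype.card_fin, NNReal.coe_inv, NNReal.coe_ofNat]
      have : (n : ℝ) - 2 ≠ 0 := by linarith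
      field_simp)
  calc eLpNorm (w.fst : _ → ℂ) (ENNReal.ofReal (2 * (n : ℝ) / ((n : ℝ) - 2))) (volume.restrict Ω)
      = eLpNorm φ (ENNReal.ofReal (2 * (n : ℝ) / ((n : ℝ) - 2))) (volume.restrict Ω) :=
        eLpNorm_congr_ae hw
    _ ≤ eLpNorm φ (ENNReal.ofReal (2 * (n : ℝ) / ((n : ℝ) - 2))) volume :=
        eLpNorm_restrict_le _ _ _ _
    _ ≤ C * eLpNorm (fderiv ℝ φ) 2 volume := hsob
    _ ≤ C * (n * ‖w‖ₑ) := by gcongr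
    _ = (C * n : ℝ≥0) * ‖w‖ₑ := by push_cast; rw [mul_assoc]

/-- The Sobolev embedding `H¹₀(Ω) ⊆ L^{2n/(n-2)}(Ω)`. -/
theorem exists_eLpNorm_fn_le (hn : 3 ≤ n) (Ω : Set (EuclideanSpace ℝ (Fin n))) :
    ∃ S : ℝ≥0, ∀ u : H10 Ω,
      eLpNorm (fn u) (ENNReal.ofReal (2 * (n : ℝ) / ((n : ℝ) - 2)))
        (volume.restrict Ω) ≤ S * ‖u‖ₑ := by
  obtain ⟨S, hS⟩ := exists_eLpNorm_fst_le_of_mem_testJets hn Ω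
  refine ⟨S, fun u => ?_⟩
  obtain ⟨w, hw, hlim⟩ := mem_closure_iff_seq_limit.mp u.2
  have hfst : Tendsto (fun k => (w k).fst) atTop (𝓝 (u : Jet Ω).fst) :=
    ((WithLp.fstL 2 ℂ _ _).continuous.tendsto _).comp hlim
  obtain ⟨ns, hns, hae⟩ := (tendstoInMeasure_of_tendsto_Lp hfst).exists_seq_tendsto_ae
  have hnorm : Tendsto (fun k => (S : ℝ≥0∞) * ‖w (ns k)‖ₑ) atTop (𝓝 (S * ‖u‖ₑ)) :=
    ENNReal.Tendsto.const_mul ((continuous_enorm.tendsto _).comp (hlim.comp hns.tendsto_atTop))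
      (Or.inr ENNReal.coe_ne_top)
  -- Fatou along an a.e. convergent subsequence of test functions carries the bound to the closure.
  calc eLpNorm (fn u) (ENNReal.ofReal (2 * (n : ℝ) / ((n : ℝ) - 2))) (volume.restrict Ω)
      ≤ liminf (fun k => eLpNorm ((w (ns k)).fst : _ → ℂ)
          (ENNReal.ofReal (2 * (n : ℝ) / ((n : ℝ) - 2))) (volume.restrict Ω)) atTop :=
        Lp.eLpNorm_lim_le_liminf_eLpNorm (fun k => Lp.aestronglyMeasurable _) _ hae
    _ ≤ liminf (fun k => (S : ℝ≥0∞) * ‖w (ns k)‖ₑ) atTop :=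
        liminf_le_liminf (Eventually.of_forall fun k => hS _ (hw _))
    _ = S * ‖u‖ₑ := hnorm.liminf_eq

theorem aestronglyMeasurable_fn (u : H10 Ω) :
    AEStronglyMeasurable (fn u) (volume.restrict Ω) :=
  Lp.aestronglyMeasurable _

theorem fn_add (u v : H10 Ω) : fn (u + v) =ᵐ[volume.restrict Ω] fn u + fn v :=
  Lp.coeFn_add (u : Jet Ω).fst (v : Jet Ω).fst

theorem fn_smul (c : ℂ) (u : H10 Ω) : fn (c • u) =ᵐ[volume.restrict Ω] c • fn u :=
  Lp.coeFn_smul c (u : Jet Ω).fst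

/-! ### Functionals given by functions, and the potential -/

/-- If `H¹₀(Ω)` embeds into `L^s(Ω)` and `r` is conjugate to `s`, then each `f ∈ L^r(Ω)` gives an
element of `H⁻¹(Ω)`. -/
theorem exists_isGivenBy {r s : ℝ≥0∞} [ENNReal.HolderConjugate r s] {S : ℝ≥0}
    (hS : ∀ u : H10 Ω, eLpNorm (fn u) s (volume.restrict Ω) ≤ S * ‖u‖ₑ)
    {f : EuclideanSpace ℝ (Fin n) → ℂ} (hf : MemLp f r (volume.restrict Ω)) :
    ∃ F : HNegOne Ω, IsGivenBy F f ∧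
      ‖F‖ ≤ S * (eLpNorm f r (volume.restrict Ω)).toReal := by
  have hLp (v : H10 Ω) : MemLp (fun x => f x * conj (fn v x)) 1 (volume.restrict Ω) := by
    refine MemLp.mul' (p := r) (q := s) ?_ hf
    exact MemLp.star ⟨aestronglyMeasurable_fn v,
      (hS v).trans_lt (ENNReal.mul_lt_top ENNReal.coe_lt_top enorm_lt_top)⟩
  have hint (v : H10 Ω) : IntegrableOn (fun x => f x * conj (fn v x)) Ω :=
    memLp_one_iff_integrable.mp (hLp v)
  let F₀ : H10 Ω →ₗ⋆[ℂ] ℂ :=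
    { toFun := fun v => ∫ x in Ω, f x * conj (fn v x)
      map_add' := fun v w => by
        rw [← integral_add (hint v) (hint w)]
        refine integral_congr_ae ((fn_add v w).mono fun x hx => ?_)
        simp only [hx, Pi.add_apply, map_add, mul_add]
      map_smul' := fun c v => by
        rw [smul_eq_mul, ← integral_const_mul]
        refine integral_congr_ae ((fn_smul c v).mono fun x hx => ?_)
        simp only [hx, Pi.smul_apply, smul_eq_mul, map_mul]
        ring }
  have hbound (v : H10 Ω) :
      ‖F₀ v‖ ≤ S * (eLpNorm f r (volume.restrict Ω)).toReal * ‖v‖ := by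
    have h1 : ‖F₀ v‖ₑ ≤ eLpNorm f r (volume.restrict Ω) * (S * ‖v‖ₑ) := by
      calc ‖F₀ v‖ₑ ≤ ∫⁻ x in Ω, ‖f x * conj (fn v x)‖ₑ := enorm_integral_le_lintegral_enorm _
        _ = eLpNorm (fun x => f x * conj (fn v x)) 1 (volume.restrict Ω) :=
          eLpNorm_one_eq_lintegral_enorm.symm
        _ ≤ (1 : ℝ≥0) * eLpNorm f r (volume.restrict Ω) *
              eLpNorm (fn v) s (volume.restrict Ω) :=
          eLpNorm_le_eLpNorm_mul_eLpNorm'_of_norm hf.1 (aestronglyMeasurable_fn v)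
            (fun a b => a * conj b) 1 (Eventually.of_forall fun x => by simp)
        _ ≤ eLpNorm f r (volume.restrict Ω) * (S * ‖v‖ₑ) := by
          rw [ENNReal.coe_one, one_mul]
          exact mul_le_mul_right (hS v) _
    have h2 := ENNReal.toReal_mono (ENNReal.mul_ne_top hf.2.ne
      (ENNReal.mul_ne_top ENNReal.coe_ne_top enorm_ne_top)) h1
    simp only [ENNReal.toReal_mul, toReal_enorm, ENNReal.coe_toReal] at h2
    linarith
  exact ⟨F₀.mkContinuous _ hbound, fun v => ⟨hint v, rfl⟩,
    F₀.mkContinuous_norm_le (by positivity) hbound⟩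

/-- With the closure properties below, this makes a pointwise choice of functionals linear in `u`.
-/
theorem IsGivenBy.unique {F G : HNegOne Ω} {f : EuclideanSpace ℝ (Fin n) → ℂ}
    (hF : IsGivenBy F f) (hG : IsGivenBy G f) : F = G :=
  ContinuousLinearMap.ext fun v => by rw [(hF v).2, (hG v).2]

theorem IsGivenBy.congr {F : HNegOne Ω} {f g : EuclideanSpace ℝ (Fin n) → ℂ}
    (hF : IsGivenBy F f) (h : f =ᵐ[volume.restrict Ω] g) : IsGivenBy F g := fun v => by
  have h' : (fun x => f x * conj (fn v x)) =ᵐ[volume.restrict Ω] fun x => g x * conj (fn v x) :=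
    h.mono fun x hx => by simp only [hx]
  exact ⟨(hF v).1.congr h', by rw [(hF v).2, integral_congr_ae h']⟩

theorem IsGivenBy.add {F G : HNegOne Ω} {f g : EuclideanSpace ℝ (Fin n) → ℂ}
    (hF : IsGivenBy F f) (hG : IsGivenBy G g) : IsGivenBy (F + G) (f + g) := fun v => by
  simp only [Pi.add_apply, add_mul]
  refine ⟨(hF v).1.add (hG v).1, ?_⟩
  rw [integral_add (hF v).1 (hG v).1, add_apply, (hF v).2, (hG v).2]

theorem IsGivenBy.smul {F : HNegOne Ω} {f : EuclideanSpace ℝ (Fin n) → ℂ}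
    (hF : IsGivenBy F f) (c : ℂ) : IsGivenBy (c • F) (c • f) := fun v => by
  simp only [Pi.smul_apply, smul_eq_mul, mul_assoc]
  refine ⟨(hF v).1.const_mul c, ?_⟩
  rw [integral_const_mul, smul_apply, (hF v).2, smul_eq_mul]

/-- Multiplication by `q ∈ L^t(Ω)` is bounded from `H¹₀(Ω)` to `H⁻¹(Ω)` if `H¹₀(Ω)` embeds into
`L^s(Ω)` and `1/t + 2/s = 1`. -/
theorem exists_mulPotential {r s t : ℝ≥0∞} [ENNReal.HolderConjugate r s]
    [ENNReal.HolderTriple t s r] {S : ℝ≥0}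
    (hS : ∀ u : H10 Ω, eLpNorm (fn u) s (volume.restrict Ω) ≤ S * ‖u‖ₑ)
    {q : EuclideanSpace ℝ (Fin n) → ℝ} (hq : MemLp q t (volume.restrict Ω)) :
    ∃ Q : H10 Ω →L[ℂ] HNegOne Ω, ∀ u, IsGivenBy (Q u) fun x => (q x : ℂ) * fn u x := by
  have hqu (u : H10 Ω) : MemLp (fun x => (q x : ℂ) * fn u x) r (volume.restrict Ω) := by
    refine MemLp.mul' (p := t) (q := s) ?_ hq.ofReal
    exact ⟨aestronglyMeasurable_fn u,
      (hS u).trans_lt (ENNReal.mul_lt_top ENNReal.coe_lt_top enorm_lt_top)⟩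
  choose Q hQ hQb using fun u => exists_isGivenBy hS (hqu u)
  let Q₀ : H10 Ω →ₗ[ℂ] HNegOne Ω :=
    { toFun := Q
      map_add' := fun u v => (hQ _).unique <| ((hQ u).add (hQ v)).congr <|
        (fn_add u v).mono fun x hx => by simp only [hx, Pi.add_apply, mul_add]
      map_smul' := fun c u => (hQ _).unique <| ((hQ u).smul c).congr <|
        (fn_smul c u).mono fun x hx => by
          simp only [hx, Pi.smul_apply, smul_eq_mul]
          ring }
  suffices hbound : ∀ u, ‖Q₀ u‖ ≤ S * ((eLpNorm q t (volume.restrict Ω)).toReal * S) * ‖u‖ by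
    exact ⟨LinearMap.mkContinuous (E := H10 Ω) (F := HNegOne Ω) Q₀ _ hbound, hQ⟩
  intro u
  have h1 : eLpNorm (fun x => (q x : ℂ) * fn u x) r (volume.restrict Ω) ≤
      eLpNorm q t (volume.restrict Ω) * (S * ‖u‖ₑ) := by
    calc eLpNorm (fun x => (q x : ℂ) * fn u x) r (volume.restrict Ω)
        ≤ (1 : ℝ≥0) * eLpNorm q t (volume.restrict Ω) * eLpNorm (fn u) s (volume.restrict Ω) :=
          eLpNorm_le_eLpNorm_mul_eLpNorm'_of_norm hq.1 (aestronglyMeasurable_fn u)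
            (fun a b => (a : ℂ) * b) 1 (Eventually.of_forall fun x => by simp)
      _ ≤ eLpNorm q t (volume.restrict Ω) * (S * ‖u‖ₑ) := by
          rw [ENNReal.coe_one, one_mul]
          exact mul_le_mul_right (hS u) _
  have h2 := ENNReal.toReal_mono (ENNReal.mul_ne_top hq.2.ne
    (ENNReal.mul_ne_top ENNReal.coe_ne_top enorm_ne_top)) h1
  simp only [ENNReal.toReal_mul, toReal_enorm, ENNReal.coe_toReal] at h2
  calc ‖Q u‖ ≤ S * _ := hQb u
    _ ≤ S * ((eLpNorm q t (volume.restrict Ω)).toReal * (S * ‖u‖)) :=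
        mul_le_mul_of_nonneg_left h2 S.2
    _ = _ := by ring

/-! ### The Schrödinger form and its resolvent -/

/-- The bounded sesquilinear form `(u, v) ↦ ∫ (P u) conj (P v)` for bounded `P : H¹₀ → L²`. -/
def pullbackInner (P : H10 Ω →L[ℂ] L2 Ω) : H10 Ω →L[ℂ] HNegOne Ω :=
  -- The flip moves conjugate-linearity from the first slot to the second.
  (innerSL ℂ).flip.bilinearComp P P

theorem pullbackInner_apply (P : H10 Ω →L[ℂ] L2 Ω) (u v : H10 Ω) :
    pullbackInner P u v = ∫ x in Ω, P u x * conj (P v x) := by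
  change ⟪P v, P u⟫_ℂ = _
  rw [L2.inner_def]
  rfl

/-- The embedding `H¹₀(Ω) → L²(Ω)`. -/
def fnL (Ω : Set (EuclideanSpace ℝ (Fin n))) : H10 Ω →L[ℂ] L2 Ω :=
  (WithLp.fstL 2 ℂ _ _).comp (H10 Ω).subtypeL

/-- The weak partial derivative as a bounded operator `H¹₀(Ω) → L²(Ω)`. -/
def gradL (Ω : Set (EuclideanSpace ℝ (Fin n))) (i : Fin n) : H10 Ω →L[ℂ] L2 Ω :=
  (PiLp.proj 2 (fun _ : Fin n => L2 Ω) i).comp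
    ((WithLp.sndL 2 ℂ _ _).comp (H10 Ω).subtypeL)

theorem integral_self_mul_conj (f : EuclideanSpace ℝ (Fin n) → ℂ) :
    ∫ x in Ω, f x * conj (f x) = ((∫ x in Ω, ‖f x‖ ^ 2 : ℝ) : ℂ) := by
  rw [← integral_complex_ofReal]
  refine integral_congr_ae (Eventually.of_forall fun x => ?_)
  simp only [Complex.mul_conj, Complex.normSq_eq_norm_sq]

/-- Holds because `q` is real; the distance estimate needs a real `P`. -/
theorem form_self_eq_re (q : EuclideanSpace ℝ (Fin n) → ℝ) (u : H10 Ω) :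
    form q u u = ((form q u u).re : ℂ) := by
  have h : ∫ x in Ω, (q x : ℂ) * fn u x * conj (fn u x) =
      ((∫ x in Ω, q x * ‖fn u x‖ ^ 2 : ℝ) : ℂ) := by
    rw [← integral_complex_ofReal]
    refine integral_congr_ae (Eventually.of_forall fun x => ?_)
    simp only [mul_assoc, Complex.mul_conj, Complex.normSq_eq_norm_sq, Complex.ofReal_mul]
  rw [form, h]
  simp only [integral_self_mul_conj, ← Complex.ofReal_sum, ← Complex.ofReal_add,
    Complex.ofReal_re]

/-- `-Δ + q - z` as a bounded operator from `H¹₀(Ω)` to `H⁻¹(Ω)`. -/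
theorem exists_schrodingerOperator {q : EuclideanSpace ℝ (Fin n) → ℝ}
    {Q : H10 Ω →L[ℂ] HNegOne Ω} (hQ : ∀ u, IsGivenBy (Q u) fun x => (q x : ℂ) * fn u x)
    (z : ℂ) :
    ∃ T : H10 Ω →L[ℂ] HNegOne Ω, ∀ u v,
      T u v = form q u v - z * ∫ x in Ω, fn u x * conj (fn v x) := by
  refine ⟨∑ i, pullbackInner (gradL Ω i) + Q - z • pullbackInner (fnL Ω), fun u v => ?_⟩
  simp only [sub_apply, add_apply,
    smul_apply, sum_apply, pullbackInner_apply,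
    (hQ u v).2, smul_eq_mul]
  rfl

/-- For positive `-Δ + q` the resolvent at `τ(m)` exists and has norm `O(m)` from `H⁻¹` to `H¹₀`. -/
theorem exists_resolvent_bound {q : EuclideanSpace ℝ (Fin n) → ℝ} {c : ℝ} (hc : 0 < c)
    (hcoer : ∀ u : H10 Ω, c * ‖u‖ ^ 2 ≤ (form q u u).re)
    {Q : H10 Ω →L[ℂ] HNegOne Ω} (hQ : ∀ u, IsGivenBy (Q u) fun x => (q x : ℂ) * fn u x)
    {m : ℕ} (hm : 1 ≤ m) :
    ∃ R : HNegOne Ω →L[ℂ] H10 Ω, IsDirichletResolvent q (tau m) R ∧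
      ∀ F, ‖R F‖ ≤ m / c * ‖F‖ := by
  obtain ⟨T, hT⟩ := exists_schrodingerOperator hQ (tau m)
  have hm' : (0 : ℝ) < m := by exact_mod_cast hm
  have hcoerT (u : H10 Ω) : c / m * ‖u‖ ^ 2 ≤ ‖T u u‖ := by
    rw [hT, form_self_eq_re, integral_self_mul_conj]
    refine le_trans ?_ (le_norm_sub_tau_mul hm _ _)
    rw [div_mul_eq_mul_div]
    exact div_le_div_of_nonneg_right (hcoer u) hm'.le
  obtain ⟨e, he, hb⟩ := exists_equiv_of_coercive (H := H10 Ω) T (div_pos hc hm') hcoerT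
  refine ⟨e.symm.toContinuousLinearMap, fun F u => ?_, fun F => ?_⟩
  · change e.symm F = u ↔ _
    rw [e.symm_apply_eq, he, ContinuousLinearMap.ext_iff]
    simp only [hT]
    exact forall_congr' fun v => eq_comm
  · rw [← inv_div]
    exact hb F

end DirichletSchrodinger

end

open DirichletSchrodinger ENNReal

theorem lemma4 (n : ℕ) (hn : 3 ≤ n) (Ω : Set (EuclideanSpace ℝ (Fin n)))
    (hΩ : IsOpen Ω) (hΩb : Bornology.IsBounded Ω)
    (q : EuclideanSpace ℝ (Fin n) → ℝ)
    (hq : MemLp q (ENNReal.ofReal ((n : ℝ) / 2)) (volume.restrict Ω))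
    (hpos : DirichletSchrodinger.IsPositive Ω q) :
    ∃ C : ℝ, 0 < C ∧ ∀ m : ℕ, 1 ≤ m →
      ∃ R : DirichletSchrodinger.HNegOne Ω →L[ℂ] DirichletSchrodinger.H10 Ω,
        DirichletSchrodinger.IsDirichletResolvent q (DirichletSchrodinger.tau m) R ∧
        ∀ f : EuclideanSpace ℝ (Fin n) → ℂ,
          MemLp f (ENNReal.ofReal (2 * (n : ℝ) / ((n : ℝ) + 2))) (volume.restrict Ω) →
          ∃ F : DirichletSchrodinger.HNegOne Ω, DirichletSchrodinger.IsGivenBy F f ∧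
            MemLp (DirichletSchrodinger.fn (R F)) (ENNReal.ofReal (2 * (n : ℝ) / ((n : ℝ) - 2))) (volume.restrict Ω) ∧
            eLpNorm (DirichletSchrodinger.fn (R F)) (ENNReal.ofReal (2 * (n : ℝ) / ((n : ℝ) - 2)))
                (volume.restrict Ω) ≤
              ENNReal.ofReal (C * |(DirichletSchrodinger.tau m).im|) *
                eLpNorm f (ENNReal.ofReal (2 * (n : ℝ) / ((n : ℝ) + 2)))
                  (volume.restrict Ω) := by
  have hn' : (3 : ℝ) ≤ n := by exact_mod_cast hn
  have hn2 : (0 : ℝ) < n - 2 := by linarith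
  have hn0 : (0 : ℝ) < n := by linarith
  -- `(n+2)/(2n) + (n-2)/(2n) = 1`.
  have : HolderConjugate (ENNReal.ofReal (2 * (n : ℝ) / ((n : ℝ) + 2)))
      (ENNReal.ofReal (2 * (n : ℝ) / ((n : ℝ) - 2))) := by
    rw [holderConjugate_iff, ← ofReal_inv_of_pos (by positivity),
      ← ofReal_inv_of_pos (by positivity), ← ofReal_add (by positivity) (by positivity),
      ofReal_eq_one]
    field_simp
    ring
  -- `2/n + (n-2)/(2n) = (n+2)/(2n)`.
  have : HolderTriple (ENNReal.ofReal ((n : ℝ) / 2))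
      (ENNReal.ofReal (2 * (n : ℝ) / ((n : ℝ) - 2)))
      (ENNReal.ofReal (2 * (n : ℝ) / ((n : ℝ) + 2))) := by
    refine ⟨?_⟩
    rw [← ofReal_inv_of_pos (by positivity), ← ofReal_inv_of_pos (by positivity),
      ← ofReal_inv_of_pos (by positivity), ← ofReal_add (by positivity) (by positivity)]
    congr 1
    field_simp
    ring
  obtain ⟨c, hc, hcoer⟩ := hpos
  obtain ⟨S, hS⟩ := exists_eLpNorm_fn_le hn Ω
  obtain ⟨Q, hQ⟩ := exists_mulPotential (r := ENNReal.ofReal (2 * (n : ℝ) / ((n : ℝ) + 2))) hS hq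
  -- `S²/c` comes from two embeddings and the resolvent; the `+ 1` keeps the constant positive even
  -- if `S = 0`.
  refine ⟨((S : ℝ) ^ 2 + 1) / c, by positivity, fun m hm => ?_⟩
  obtain ⟨R, hR, hRb⟩ := exists_resolvent_bound hc hcoer hQ hm
  refine ⟨R, hR, fun f hf => ?_⟩
  obtain ⟨F, hF, hFb⟩ := exists_isGivenBy hS hf
  refine ⟨F, hF, ⟨aestronglyMeasurable_fn _, (hS _).trans_lt (mul_lt_top coe_lt_top enorm_lt_top)⟩,
    (hS _).trans ?_⟩
  rw [← ofReal_toReal hf.2.ne, ← ofReal_mul (by positivity), ← ofReal_coe_nnreal,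
    ← ofReal_norm, ← ofReal_mul S.coe_nonneg]
  refine ofReal_le_ofReal ?_
  generalize hN : (eLpNorm f _ (volume.restrict Ω)).toReal = N at hFb ⊢
  have hN0 : 0 ≤ N := hN ▸ toReal_nonneg
  rw [tau_im, abs_of_nonneg (by positivity)]
  calc (S : ℝ) * ‖R F‖ ≤ S * (m / c * (S * N)) := by
        gcongr
        exact (hRb F).trans (by gcongr)
    _ = (S : ℝ) ^ 2 / c * m * N := by ring
    _ ≤ ((S : ℝ) ^ 2 + 1) / c * (2 * m) * N := by
        have : (m : ℝ) ≤ 2 * m := by linarith [(Nat.cast_nonneg m : (0 : ℝ) ≤ m)]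
        gcongr
        linarith
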